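/- Let $N\ge 1$, $\eta>0$, $L>0$, and let $\Delta_N=\{x\in\mathbb R^N: x_i\ge 0 \text{ for all } i,\ \sum_{i=1}^N x_i=1\}$. Let $\epsilon=(\epsilon_1,\dots,\epsilon_N)$ be a random vector with law $F$ on $\mathbb R^N$, and define the social surplus function $$\varphi(\theta)=\mathbb E\Big[\max_{1\le i\le N}\{\theta_i+\eta\,\epsilon_i\}\Big],\qquad \theta\in\mathbb R^N .$$ Assume: 1. $F$ has (finite and) zero mean, is absolutely continuous with respect to Lebesgue measure, and has full support on $\mathbb R^N$ (and does not depend on $\theta$). 2. The Hessian $\nabla^2\varphi(\theta)$ exists and satisfies $2\,\mathrm{Tr}(\nabla^2\varphi(\theta))\le L/\eta$ for every $\theta\in\mathbb R^N$. Let $\varphi^*(\cdot\,;\eta)$ be the convex conjugate of the normalized surplus $z\mapsto \mathbb E[\max_i\{z_i+\epsilon_i\}]$ (so that $z=\theta/\eta$ and $\varphi(\theta)=\eta\,\mathbb E[\max_i\{\theta_i/\eta+\epsilon_i\}]$), and let $$\mathcal R(x)=\eta\,\varphi^*(x;\eta)=\eta\sup_{z\in\mathbb R^N}\Big\{\langle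 z,x\rangle-\mathbb E\big[\max_i\{z_i+\epsilon_i\}\big]\Big\}\in(-\infty,\infty].$$ Then: i) $\mathcal R$ is $(\eta/L)$-strongly convex with respect to the norm $\|\cdot\|_1$: for all $x,y\in\mathbb R^N$ and $\lambda\in(0,1)$, $$\mathcal R(\lambda x+(1-\lambda)y)\le\lambda\mathcal R(x)+(1-\lambda)\mathcal R(y)-\tfrac{\eta}{2L}\lambda(1-\lambda)\|x-y\|_1^2 .$$ ii) $\mathcal R$ is finite on $\Delta_N$ and, as a function on $\Delta_N$, differentiable at every point $x$ of the relative interior of $\Delta_N$: there is $g\in\mathbb R^N$ with $\mathcal R(y)=\mathcal R(x)+\langle g,y-x\rangle+o(\|y-x\|)$ as $y\to x$, $y\in\Delta_N$. iii) For every $\theta\in\mathbb R^N$ the problem $\max_{x\in\Delta_N}\{\langle\theta,x\rangle-\mathcal R(x)\}$ has a unique solution; moreover $\varphi$ is differentiable at $\theta$ and $$\nabla\varphi(\theta)=\arg\max_{x\in\Delta_N}\{\langle\theta,x\rangle-\mathcal R(x)\}.$$ -/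

import Mathlib

open MeasureTheory

noncomputable section

namespace RUM

/-- `ℝ^N` with its standard inner product. -/
abbrev Vec (N : ℕ) : Type := EuclideanSpace ℝ (Fin N)

/-- The probability simplex `Δ_N`. -/
def simplex (N : ℕ) : Set (Vec N) := {x | (∀ i, 0 ≤ x i) ∧ ∑ i, x i = 1}

/-- The `ℓ¹` norm on `ℝ^N`. -/
def l1Norm {N : ℕ} (v : Vec N) : ℝ := ∑ i, |v i|

/-- The social surplus function `φ(θ) = 𝔼[max_i (θ_i + η ε_i)]`, where `ε` has law `F`.
The supremum below runs over a finite index set, so for `N ≥ 1` it is a maximum. -/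
def socialSurplus {N : ℕ} (F : Measure (Vec N)) (η : ℝ) (θ : Vec N) : ℝ :=
  ∫ ε, (⨆ i : Fin N, (θ i + η * ε i)) ∂F

/-- The law `F` of the random shock is a probability distribution with (finite, and) zero mean,
absolutely continuous with respect to Lebesgue measure and with full support on `ℝ^N`.  It is a
fixed measure: it depends neither on the period nor on the cumulative payoff vector. -/
structure ShockAssumption {N : ℕ} (F : Measure (Vec N)) : Prop where
  isProbabilityMeasure : IsProbabilityMeasure F
  integrable : ∀ i, Integrable (fun ε : Vec N => ε i) F
  zero_mean : ∀ i, ∫ ε, ε i ∂F = 0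
  absolutelyContinuous : F ≪ (volume : Measure (Vec N))
  full_support : ∀ U : Set (Vec N), IsOpen U → U.Nonempty → 0 < F U

/-- The Hessian matrix of `f` at `θ`: the Jacobian matrix of the gradient. -/
def hessian {N : ℕ} (f : Vec N → ℝ) (θ : Vec N) : Matrix (Fin N) (Fin N) ℝ :=
  Matrix.of fun i j => (fderiv ℝ (gradient f) θ (EuclideanSpace.single j 1)) i

/-- The Hessian of the social surplus exists everywhere, and `2 Tr(∇²φ(θ)) ≤ L / η`. -/
def HessianTraceAssumption {N : ℕ} (F : Measure (Vec N)) (η L : ℝ) : Prop :=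
  ∀ θ : Vec N, DifferentiableAt ℝ (gradient (socialSurplus F η)) θ ∧
    2 * (hessian (socialSurplus F η) θ).trace ≤ L / η

/-- The convex conjugate `f*(x) = sup_z (⟨z, x⟩ - f(z))`, with values in `[-∞, ∞]`. -/
def convexConjugate {N : ℕ} (f : Vec N → ℝ) (x : Vec N) : EReal :=
  ⨆ z : Vec N, ((inner ℝ z x - f z : ℝ) : EReal)

/-- The regularizer `R(x) = η φ*(x; η)`: `φ*(· ; η)` is the convex conjugate of the normalized
surplus `z ↦ 𝔼[max_i (z_i + ε_i)]` in the rescaled variable `z = θ / η`; the social surplus with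
parameter `η` is `φ(θ) = η 𝔼[max_i (θ_i / η + ε_i)]`. -/
def regularizer {N : ℕ} (F : Measure (Vec N)) (η : ℝ) (x : Vec N) : EReal :=
  (η : EReal) * convexConjugate (socialSurplus F 1) x

/-- `f : ℝ^N → (-∞, ∞]` is `σ`-strongly convex with respect to the `ℓ¹` norm. -/
def StronglyConvexL1 {N : ℕ} (σ : ℝ) (f : Vec N → EReal) : Prop :=
  (∀ x, f x ≠ ⊥) ∧
  ∀ (x y : Vec N) (a b : ℝ), 0 < a → 0 < b → a + b = 1 →
    f (a • x + b • y) ≤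
      (a : EReal) * f x + (b : EReal) * f y - ((σ / 2 * (a * b) * l1Norm (x - y) ^ 2 : ℝ) : EReal)

/-- `x` solves the problem `max_{x ∈ Δ_N} (⟨θ, x⟩ - R(x))`. -/
def IsSolution {N : ℕ} (F : Measure (Vec N)) (η : ℝ) (θ x : Vec N) : Prop :=
  x ∈ simplex N ∧
    IsMaxOn (fun y => ((inner ℝ θ y : ℝ) : EReal) - regularizer F η y) (simplex N) x

end RUM

end

noncomputable section

namespace RUM

open Set Filter Topology

variable {N : ℕ} {F : Measure (Vec N)} {η : ℝ}

/-! The argument is Fenchel duality between smoothness of `φ` in the sup norm and strong convexity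
of its conjugate in the `ℓ¹` norm. Rescaling `θ = η z` identifies the regularizer with `φ*`.

The maximum is submodular and commutes with adding a constant, and averaging over the shock
preserves both properties. So the Hessian of `φ` has nonpositive off-diagonal entries and zero row
sums: its entries have absolute sum `2 Tr`. The trace bound thus gives `⟨∇²φ d, d⟩ ≤ (L/η) ‖d‖_∞²`
(`inner_fderiv_gradient_le`), which `stronglyConvexL1_convexConjugate` dualizes into (i).

For (ii), full support makes `φ` strictly convex on zero-sum vectors. When `x` has positive
coordinates, `φ - ⟨·, x⟩` is also coercive there, so its minimizer exists, is unique, and is the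
derivative of `φ*` along the simplex. For (iii), absolute continuity makes `φ` differentiable;
equality in Fenchel–Young at `∇φ(θ)` gives a solution, and (i) makes it unique. -/

/-- The largest coordinate of a vector. -/
def maxCoord (u : Vec N) : ℝ := ⨆ i, u i

/-- The vector all of whose coordinates are `1`. -/
def ones (N : ℕ) : Vec N := WithLp.toLp 2 fun _ => 1

@[simp] lemma ones_apply (i : Fin N) : ones N i = 1 := rfl

lemma inner_eq_sum (x y : Vec N) : inner ℝ x y = ∑ i, x i * y i := by
  simp [PiLp.inner_apply, mul_comm]

lemma le_maxCoord (u : Vec N) (i : Fin N) : u i ≤ maxCoord u :=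
  le_ciSup (f := fun i => u i) (Set.finite_range _).bddAbove i

lemma abs_apply_le_norm (u : Vec N) (i : Fin N) : |u i| ≤ ‖u‖ := by
  simpa using PiLp.norm_apply_le u i

lemma socialSurplus_eq (F : Measure (Vec N)) (η : ℝ) (θ : Vec N) :
    socialSurplus F η θ = ∫ ε, maxCoord (θ + η • ε) ∂F := rfl

lemma single_mem_simplex (i : Fin N) : EuclideanSpace.single i (1 : ℝ) ∈ simplex N := by
  refine ⟨fun k => ?_, by simp⟩
  by_cases h : k = i <;> simp [h]

lemma eq_sum_smul_single (d : Vec N) : d = ∑ j, d j • EuclideanSpace.single j (1 : ℝ) := by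
  ext i
  simp [Finset.sum_apply, Pi.single_apply]

lemma norm_le_l1Norm (u : Vec N) : ‖u‖ ≤ l1Norm u :=
  calc ‖u‖ = ‖∑ i, u i • EuclideanSpace.single i (1 : ℝ)‖ := by
        rw [← eq_sum_smul_single]
    _ ≤ ∑ i, ‖u i • EuclideanSpace.single i (1 : ℝ)‖ := norm_sum_le _ _
    _ = _ := by simp [norm_smul, l1Norm]

lemma ShockAssumption.integrable_norm (hF : ShockAssumption F) :
    Integrable (fun ε : Vec N => ‖ε‖) F := by
  have h : Integrable (fun ε : Vec N => ∑ i, |ε i|) F :=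
    integrable_finsetSum _ fun i _ => (hF.integrable i).abs
  refine h.mono' (by fun_prop) (Eventually.of_forall fun ε => ?_)
  rw [norm_norm]
  exact norm_le_l1Norm ε

/-! ### Convexity, Lipschitz bound and submodularity of the maximum. -/

section

variable [NeZero N]

lemma maxCoord_le {u : Vec N} {c : ℝ} (h : ∀ i, u i ≤ c) : maxCoord u ≤ c :=
  ciSup_le h

lemma exists_eq_maxCoord (u : Vec N) : ∃ i, u i = maxCoord u :=
  exists_eq_ciSup_of_finite (f := fun i => u i)

lemma maxCoord_mono {u v : Vec N} (h : ∀ i, u i ≤ v i) : maxCoord u ≤ maxCoord v :=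
  maxCoord_le fun i => (h i).trans (le_maxCoord v i)

lemma maxCoord_add_smul_ones (u : Vec N) (c : ℝ) :
    maxCoord (u + c • ones N) = maxCoord u + c := by
  apply le_antisymm
  · exact maxCoord_le fun i => by simpa using le_maxCoord u i
  · obtain ⟨i, hi⟩ := exists_eq_maxCoord u
    simpa [hi] using le_maxCoord (u + c • ones N) i

lemma maxCoord_smul {c : ℝ} (hc : 0 ≤ c) (u : Vec N) : maxCoord (c • u) = c * maxCoord u := by
  apply le_antisymm
  · exact maxCoord_le fun i => by simpa using mul_le_mul_of_nonneg_left (le_maxCoord u i) hc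
  · obtain ⟨i, hi⟩ := exists_eq_maxCoord u
    simpa [hi] using le_maxCoord (c • u) i

lemma maxCoord_add_le (u v : Vec N) : maxCoord (u + v) ≤ maxCoord u + maxCoord v :=
  maxCoord_le fun i => add_le_add (le_maxCoord u i) (le_maxCoord v i)

lemma convexOn_maxCoord : ConvexOn ℝ univ (maxCoord : Vec N → ℝ) := by
  refine ⟨convex_univ, fun u _ v _ a b ha hb _ => ?_⟩
  simpa [maxCoord_smul, ha, hb] using maxCoord_add_le (a • u) (b • v)

lemma maxCoord_le_norm (u : Vec N) : maxCoord u ≤ ‖u‖ :=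
  maxCoord_le fun i => (le_abs_self _).trans (abs_apply_le_norm u i)

lemma lipschitzWith_maxCoord : LipschitzWith 1 (maxCoord : Vec N → ℝ) := by
  refine LipschitzWith.of_le_add fun u v => ?_
  have := maxCoord_add_le v (u - v)
  rw [dist_eq_norm]
  have h2 := maxCoord_le_norm (u - v)
  rw [add_sub_cancel] at this
  linarith

/-- The maximum of the coordinates is submodular. -/
lemma maxCoord_submodular (u : Vec N) {i j : Fin N} (hij : i ≠ j) {s t : ℝ} (hs : 0 ≤ s)
    (ht : 0 ≤ t) :
    maxCoord (u + s • EuclideanSpace.single i 1 + t • EuclideanSpace.single j 1) + maxCoord u ≤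
      maxCoord (u + s • EuclideanSpace.single i 1) +
        maxCoord (u + t • EuclideanSpace.single j 1) := by
  have h1 : maxCoord u ≤ maxCoord (u + s • EuclideanSpace.single i 1) :=
    maxCoord_mono fun k => by
      by_cases h : k = i <;> simp [h, hs]
  have h2 : maxCoord u ≤ maxCoord (u + t • EuclideanSpace.single j 1) :=
    maxCoord_mono fun k => by
      by_cases h : k = j <;> simp [h, ht]
  obtain ⟨k, hk⟩ := exists_eq_maxCoord
    (u + s • EuclideanSpace.single i 1 + t • EuclideanSpace.single j (1 : ℝ))
  rw [← hk]
  -- The coordinate `k` attaining the maximum sees at most one of the two increments; monotonicity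
  -- accounts for the other term.
  by_cases h : k = j
  · have h3 := le_maxCoord (u + t • EuclideanSpace.single j (1 : ℝ)) k
    have : k ≠ i := fun h' => hij (h'.symm.trans h)
    simp [this] at h3 ⊢
    linarith
  · have h3 := le_maxCoord (u + s • EuclideanSpace.single i (1 : ℝ)) k
    simp [h] at h3 ⊢
    linarith

lemma continuous_maxCoord : Continuous (maxCoord : Vec N → ℝ) := lipschitzWith_maxCoord.continuous

lemma abs_maxCoord_le (u : Vec N) : |maxCoord u| ≤ ‖u‖ := by
  have h : maxCoord (0 : Vec N) = 0 := by simpa using maxCoord_smul le_rfl (0 : Vec N)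
  simpa [h, Real.dist_eq] using lipschitzWith_maxCoord.dist_le_mul u 0

/-! ### The surplus: properties obtained by averaging over the shock. -/

lemma ShockAssumption.integrable_maxCoord (hF : ShockAssumption F) (η : ℝ) (θ : Vec N) :
    Integrable (fun ε => maxCoord (θ + η • ε)) F := by
  have := hF.isProbabilityMeasure
  refine ((integrable_const ‖θ‖).add (hF.integrable_norm.const_mul |η|)).mono'
    (continuous_maxCoord.comp (by fun_prop)).aestronglyMeasurable (Eventually.of_forall fun ε => ?_)
  refine (abs_maxCoord_le _).trans ((norm_add_le _ _).trans ?_)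
  simp [norm_smul]

lemma convexOn_socialSurplus (hF : ShockAssumption F) :
    ConvexOn ℝ univ (socialSurplus F η) := by
  refine ⟨convex_univ, fun u _ v _ a b ha hb hab => ?_⟩
  have hi := hF.integrable_maxCoord η
  simp only [socialSurplus_eq, smul_eq_mul, ← integral_const_mul]
  rw [← integral_add ((hi u).const_mul a) ((hi v).const_mul b)]
  refine integral_mono (hi _) (((hi u).const_mul a).add ((hi v).const_mul b)) fun ε => ?_
  have h : a • u + b • v + η • ε = a • (u + η • ε) + b • (v + η • ε) := by
    obtain rfl : a = 1 - b := by linarith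
    module
  simp only [h]
  exact convexOn_maxCoord.2 (mem_univ (u + η • ε)) (mem_univ (v + η • ε)) ha hb hab

lemma socialSurplus_mono (hF : ShockAssumption F) {u v : Vec N} (h : ∀ i, u i ≤ v i) :
    socialSurplus F η u ≤ socialSurplus F η v :=
  integral_mono (hF.integrable_maxCoord η u) (hF.integrable_maxCoord η v) fun ε =>
    maxCoord_mono (u := u + η • ε) (v := v + η • ε) fun i => by simpa using h i

lemma socialSurplus_add_smul_ones (hF : ShockAssumption F) (θ : Vec N) (c : ℝ) :
    socialSurplus F η (θ + c • ones N) = socialSurplus F η θ + c := by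
  have := hF.isProbabilityMeasure
  simp only [socialSurplus_eq, add_right_comm θ, maxCoord_add_smul_ones]
  rw [integral_add (hF.integrable_maxCoord η θ) (integrable_const c)]
  simp

lemma socialSurplus_submodular (hF : ShockAssumption F) (u : Vec N) {i j : Fin N} (hij : i ≠ j)
    {s t : ℝ} (hs : 0 ≤ s) (ht : 0 ≤ t) :
    socialSurplus F η (u + s • EuclideanSpace.single i 1 + t • EuclideanSpace.single j 1) +
        socialSurplus F η u ≤
      socialSurplus F η (u + s • EuclideanSpace.single i 1) +
        socialSurplus F η (u + t • EuclideanSpace.single j 1) := by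
  have hi := hF.integrable_maxCoord η
  simp only [socialSurplus_eq]
  rw [← integral_add (hi _) (hi _), ← integral_add (hi _) (hi _)]
  refine integral_mono ((hi _).add (hi _)) ((hi _).add (hi _)) fun ε => ?_
  simpa only [add_right_comm _ _ (η • ε)] using maxCoord_submodular (u + η • ε) hij hs ht

/-- A maximum dominates every convex combination of the coordinates, and zero mean removes the shock
from the combination. This bounds the conjugate above by `0` on the simplex. -/
lemma inner_le_socialSurplus (hF : ShockAssumption F) {x : Vec N} (hx : x ∈ simplex N)
    (θ : Vec N) : inner ℝ θ x ≤ socialSurplus F η θ := by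
  have := hF.isProbabilityMeasure
  have hint : ∀ i, Integrable (fun ε : Vec N => (θ i + η * ε i) * x i) F := fun i =>
    ((integrable_const _).add ((hF.integrable i).const_mul η)).mul_const _
  calc inner ℝ θ x = ∫ ε, ∑ i, (θ i + η * ε i) * x i ∂F := by
        rw [integral_finsetSum _ fun i _ => hint i, inner_eq_sum]
        refine Finset.sum_congr rfl fun i _ => ?_
        rw [integral_mul_const, integral_add (integrable_const _) ((hF.integrable i).const_mul η),
          integral_const_mul, hF.zero_mean i]
        simp
    _ ≤ _ := by
        refine integral_mono (integrable_finsetSum _ fun i _ => hint i)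
          (hF.integrable_maxCoord η θ) fun ε => ?_
        calc ∑ i, (θ i + η * ε i) * x i ≤ ∑ i, maxCoord (θ + η • ε) * x i :=
              Finset.sum_le_sum fun i _ => mul_le_mul_of_nonneg_right
                (by simpa using le_maxCoord (θ + η • ε) i) (hx.1 i)
          _ = maxCoord (θ + η • ε) := by rw [← Finset.mul_sum, hx.2, mul_one]

lemma maxCoord_le_socialSurplus (hF : ShockAssumption F) (θ : Vec N) :
    maxCoord θ ≤ socialSurplus F η θ := by
  refine maxCoord_le fun i => ?_
  simpa [inner_eq_sum] using inner_le_socialSurplus (η := η) hF (single_mem_simplex i) θ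

/-- By Rademacher the maximum is differentiable Lebesgue-a.e.; absolute continuity and `η ≠ 0` carry
this to `θ + η ε` for `F`-almost every `ε`. The Lipschitz constant `1` dominates the difference
quotients. -/
lemma differentiableAt_socialSurplus (hF : ShockAssumption F) (hη : η ≠ 0) (θ : Vec N) :
    DifferentiableAt ℝ (socialSurplus F η) θ := by
  have := hF.isProbabilityMeasure
  have hae : ∀ᵐ ε ∂F, DifferentiableAt ℝ (maxCoord : Vec N → ℝ) (θ + η • ε) := by
    suffices h : ∀ᵐ ε ∂volume, DifferentiableAt ℝ (maxCoord : Vec N → ℝ) (θ + η • ε) from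
      hF.absolutelyContinuous.ae_le h
    have h := (lipschitzWith_maxCoord (N := N)).ae_differentiableAt (μ := volume)
    rw [ae_iff] at h ⊢
    change volume ((fun ε : Vec N => η • ε) ⁻¹' ((fun u : Vec N => θ + u) ⁻¹'
      {a | ¬DifferentiableAt ℝ (maxCoord : Vec N → ℝ) a})) = 0
    rw [Measure.addHaar_preimage_smul _ hη, measure_preimage_add, h, mul_zero]
  have key := hasFDerivAt_integral_of_dominated_loc_of_lip' (μ := F) (s := univ)
    (F := fun θ ε => maxCoord (θ + η • ε)) (x₀ := θ) (bound := fun _ => 1) (𝕜 := ℝ)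
    (F' := fun ε => fderiv ℝ (maxCoord : Vec N → ℝ) (θ + η • ε)) univ_mem
    (fun x _ => (hF.integrable_maxCoord η x).aestronglyMeasurable)
    (hF.integrable_maxCoord η θ)
    ((measurable_fderiv ℝ (maxCoord : Vec N → ℝ)).comp (by fun_prop)).aestronglyMeasurable
    (Eventually.of_forall fun ε x _ => by
      simpa [dist_eq_norm] using lipschitzWith_maxCoord.dist_le_mul (x + η • ε) (θ + η • ε))
    (integrable_const _)
    (hae.mono fun ε h => by
      simpa [Function.comp_def] using h.hasFDerivAt.comp θ ((hasFDerivAt_id θ).add_const (η • ε)))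
  exact key.2.differentiableAt

/-- Strict convexity transverse to `ones`: the convexity defect `D` of the maximum is continuous and
nonnegative with zero integral, so full support makes it vanish everywhere. -/
lemma eq_of_socialSurplus_midpoint_eq (hF : ShockAssumption F) (hη : η ≠ 0) {θ θ' : Vec N}
    (hsum : ∑ i, θ i = ∑ i, θ' i)
    (h : socialSurplus F η ((1 / 2 : ℝ) • θ + (1 / 2 : ℝ) • θ') =
      1 / 2 * socialSurplus F η θ + 1 / 2 * socialSurplus F η θ') : θ = θ' := by
  have hi := hF.integrable_maxCoord η
  set D : Vec N → ℝ := fun ε => 1 / 2 * maxCoord (θ + η • ε) + 1 / 2 * maxCoord (θ' + η • ε) -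
    maxCoord ((1 / 2 : ℝ) • θ + (1 / 2 : ℝ) • θ' + η • ε) with hD
  have hcont : ∀ u : Vec N, Continuous fun ε : Vec N => maxCoord (u + η • ε) := fun u =>
    continuous_maxCoord.comp (by fun_prop)
  have hDc : Continuous D := (((hcont _).const_mul _).add ((hcont _).const_mul _)).sub (hcont _)
  have hA : Integrable (fun ε => 1 / 2 * maxCoord (θ + η • ε) +
    1 / 2 * maxCoord (θ' + η • ε)) F := ((hi _).const_mul _).add ((hi _).const_mul _)
  have hDi : Integrable D F := hA.sub (hi _)
  have hD0 : 0 ≤ D := fun ε => by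
    have := convexOn_maxCoord.2 (mem_univ (θ + η • ε)) (mem_univ (θ' + η • ε))
      (by norm_num : (0 : ℝ) ≤ 1 / 2) (by norm_num : (0 : ℝ) ≤ 1 / 2) (by norm_num)
    rw [show (1 / 2 : ℝ) • (θ + η • ε) + (1 / 2 : ℝ) • (θ' + η • ε) =
      (1 / 2 : ℝ) • θ + (1 / 2 : ℝ) • θ' + η • ε by module] at this
    simpa [hD] using this
  have hint : ∫ ε, D ε ∂F = 0 := by
    rw [hD, integral_sub hA (hi _),
      integral_add ((hi _).const_mul _) ((hi _).const_mul _), integral_const_mul,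
      integral_const_mul]
    simp only [← socialSurplus_eq]
    linarith
  have hopen : F.IsOpenPosMeasure := ⟨fun U hU hne => (hF.full_support U hU hne).ne'⟩
  have hzero : D = fun _ => 0 := by
    rw [← hDc.ae_eq_iff_eq F continuous_const]
    exact (integral_eq_zero_iff_of_nonneg hD0 hDi).1 hint
  -- This shock moves the midpoint to the origin, leaving `max (θ - θ') + max (θ' - θ) = 0`: the
  -- difference is a constant vector, hence zero by `hsum`.
  have hd := congrFun hzero (η⁻¹ • -((1 / 2 : ℝ) • θ + (1 / 2 : ℝ) • θ'))
  simp only [hD, smul_inv_smul₀ hη, add_neg_cancel] at hd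
  have hm0 : maxCoord (0 : Vec N) = 0 := by simpa using maxCoord_smul le_rfl (0 : Vec N)
  rw [hm0, show θ + -((1 / 2 : ℝ) • θ + (1 / 2 : ℝ) • θ') = (1 / 2 : ℝ) • (θ - θ') by module,
    show θ' + -((1 / 2 : ℝ) • θ + (1 / 2 : ℝ) • θ') = (1 / 2 : ℝ) • (θ' - θ) by module,
    maxCoord_smul (by norm_num), maxCoord_smul (by norm_num)] at hd
  have hle : ∀ i, θ i - θ' i ≤ maxCoord (θ - θ') := le_maxCoord (θ - θ')
  have hge : ∀ i, maxCoord (θ - θ') ≤ θ i - θ' i := fun i => by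
    have := le_maxCoord (θ' - θ) i
    simp only [PiLp.sub_apply] at this
    linarith
  have hc : ∀ i, θ i - θ' i = maxCoord (θ - θ') := fun i => (hle i).antisymm (hge i)
  have hs : ∑ i, (θ i - θ' i) = 0 := by rw [Finset.sum_sub_distrib, hsum, sub_self]
  simp only [hc, Finset.sum_const, Finset.card_univ, Fintype.card_fin, nsmul_eq_mul,
    mul_eq_zero, NeZero.ne, false_or] at hs
  ext i
  have := hc i
  linarith

end

/-! ### Sign structure of the Hessian and smoothness in the sup norm. -/

lemma hasDerivAt_comp_line {E : Type*} [NormedAddCommGroup E] [NormedSpace ℝ E] {f : Vec N → E}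
    {θ d : Vec N} {t : ℝ} (hf : DifferentiableAt ℝ f (θ + t • d)) :
    HasDerivAt (fun s : ℝ => f (θ + s • d)) (fderiv ℝ f (θ + t • d) d) t := by
  have h : HasDerivAt (fun s : ℝ => θ + s • d) d t := by
    simpa using ((hasDerivAt_id t).smul_const d).const_add θ
  exact hf.hasFDerivAt.comp_hasDerivAt t h

lemma gradient_apply (f : Vec N → ℝ) (θ : Vec N) (i : Fin N) :
    gradient f θ i = fderiv ℝ f θ (EuclideanSpace.single i 1) := by
  rw [← inner_gradient_left, inner_eq_sum]
  simp

lemma fderiv_gradient_apply (f : Vec N → ℝ) (θ d : Vec N) (i : Fin N) :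
    fderiv ℝ (gradient f) θ d i = ∑ j, d j * hessian f θ i j := by
  conv_lhs => rw [eq_sum_smul_single d]
  simp [hessian, Finset.sum_apply]

section

variable [NeZero N]

lemma gradient_add_smul_ones (hF : ShockAssumption F) (θ : Vec N) (c : ℝ) :
    gradient (socialSurplus F η) (θ + c • ones N) = gradient (socialSurplus F η) θ := by
  rw [gradient, gradient, ← fderiv_comp_add_right]
  simp only [socialSurplus_add_smul_ones hF, fderiv_add_const]

/-- Infinitesimal submodularity: raising coordinate `j` lowers the gain from raising `i`. It yields
the sign of the mixed derivatives. -/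
lemma antitone_gradient_apply (hF : ShockAssumption F) (hη : η ≠ 0) (θ : Vec N) {i j : Fin N}
    (hij : i ≠ j) :
    Antitone fun t : ℝ =>
      gradient (socialSurplus F η) (θ + t • EuclideanSpace.single j 1) i := by
  intro t₁ t₂ ht
  have hd := differentiableAt_socialSurplus hF hη
  have hk := (hasDerivAt_comp_line (t := 0) (d := EuclideanSpace.single i (1 : ℝ))
    (hd (θ + t₂ • EuclideanSpace.single j 1 + (0 : ℝ) • EuclideanSpace.single i 1))).sub
    (hasDerivAt_comp_line (t := 0) (d := EuclideanSpace.single i (1 : ℝ))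
    (hd (θ + t₁ • EuclideanSpace.single j 1 + (0 : ℝ) • EuclideanSpace.single i 1)))
  have := hk.nonpos_of_antitone fun s₁ s₂ hs => by
    have := socialSurplus_submodular (η := η) hF
      (θ + t₁ • EuclideanSpace.single j 1 + s₁ • EuclideanSpace.single i 1) hij
      (sub_nonneg.2 hs) (sub_nonneg.2 ht)
    rw [show θ + t₁ • EuclideanSpace.single j 1 + s₁ • EuclideanSpace.single i 1 +
        (s₂ - s₁) • EuclideanSpace.single i 1 + (t₂ - t₁) • EuclideanSpace.single j (1 : ℝ) =
        θ + t₂ • EuclideanSpace.single j 1 + s₂ • EuclideanSpace.single i 1 by module,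
      show θ + t₁ • EuclideanSpace.single j 1 + s₁ • EuclideanSpace.single i 1 +
        (s₂ - s₁) • EuclideanSpace.single i (1 : ℝ) =
        θ + t₁ • EuclideanSpace.single j 1 + s₂ • EuclideanSpace.single i 1 by module,
      show θ + t₁ • EuclideanSpace.single j 1 + s₁ • EuclideanSpace.single i 1 +
        (t₂ - t₁) • EuclideanSpace.single j (1 : ℝ) =
        θ + t₂ • EuclideanSpace.single j 1 + s₁ • EuclideanSpace.single i 1 by module] at this
    simp only [Pi.sub_apply]
    linarith
  simp only [zero_smul, add_zero, ← gradient_apply] at this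
  simpa using this

lemma hessian_nonpos (hF : ShockAssumption F) (hη : η ≠ 0) {θ : Vec N}
    (hθ : DifferentiableAt ℝ (gradient (socialSurplus F η)) θ) {i j : Fin N} (hij : i ≠ j) :
    hessian (socialSurplus F η) θ i j ≤ 0 := by
  have h := hasDerivAt_comp_line (t := 0) (d := EuclideanSpace.single j (1 : ℝ))
    (show DifferentiableAt ℝ (gradient (socialSurplus F η))
      (θ + (0 : ℝ) • EuclideanSpace.single j 1) by simpa using hθ)
  have h' := (EuclideanSpace.proj i : Vec N →L[ℝ] ℝ).hasFDerivAt.comp_hasDerivAt 0 h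
  have := h'.nonpos_of_antitone (antitone_gradient_apply hF hη θ hij)
  simpa [hessian] using this

lemma sum_hessian_eq_zero (hF : ShockAssumption F) {θ : Vec N}
    (hθ : DifferentiableAt ℝ (gradient (socialSurplus F η)) θ) (i : Fin N) :
    ∑ j, hessian (socialSurplus F η) θ i j = 0 := by
  have h := hasDerivAt_comp_line (t := 0) (d := ones N)
    (show DifferentiableAt ℝ (gradient (socialSurplus F η)) (θ + (0 : ℝ) • ones N) by
      simpa using hθ)
  simp only [gradient_add_smul_ones hF] at h
  have h0 := h.unique (hasDerivAt_const _ _)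
  have := fderiv_gradient_apply (socialSurplus F η) θ (ones N) i
  simp only [ones_apply, one_mul] at this
  rw [← this]
  simpa using congrArg (fun v : Vec N => v i) h0

lemma sum_abs_hessian_eq (hF : ShockAssumption F) (hη : η ≠ 0) {θ : Vec N}
    (hθ : DifferentiableAt ℝ (gradient (socialSurplus F η)) θ) (i : Fin N) :
    ∑ j, |hessian (socialSurplus F η) θ i j| = 2 * hessian (socialSurplus F η) θ i i := by
  have h0 := sum_hessian_eq_zero hF hθ i
  rw [← Finset.add_sum_erase _ _ (Finset.mem_univ i)] at h0 ⊢
  have hoff : ∀ j ∈ Finset.univ.erase i, hessian (socialSurplus F η) θ i j ≤ 0 := fun j hj =>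
    hessian_nonpos hF hη hθ (Finset.ne_of_mem_erase hj).symm
  have hle := Finset.sum_nonpos hoff
  rw [Finset.sum_congr rfl fun j hj => abs_of_nonpos (hoff j hj), Finset.sum_neg_distrib,
    abs_of_nonneg (by linarith)]
  linarith

lemma inner_fderiv_gradient_le (hF : ShockAssumption F) (hη : η ≠ 0) {θ d : Vec N} {m : ℝ}
    (hθ : DifferentiableAt ℝ (gradient (socialSurplus F η)) θ) (hd : ∀ i, |d i| ≤ m) :
    inner ℝ (fderiv ℝ (gradient (socialSurplus F η)) θ d) d ≤
      2 * (hessian (socialSurplus F η) θ).trace * m ^ 2 := by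
  have hm : 0 ≤ m := (abs_nonneg _).trans (hd 0)
  rw [inner_eq_sum, Matrix.trace, Finset.mul_sum, Finset.sum_mul]
  refine Finset.sum_le_sum fun i _ => ?_
  rw [Matrix.diag_apply, ← sum_abs_hessian_eq hF hη hθ i, fderiv_gradient_apply, Finset.sum_mul,
    Finset.sum_mul]
  refine Finset.sum_le_sum fun j _ => (le_abs_self _).trans ?_
  rw [abs_mul, abs_mul, sq, mul_comm |d j|, mul_assoc]
  gcongr
  · exact hd j
  · exact hd i

/-- A bound on the trace of the Hessian makes the surplus smooth in the sup norm. -/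
lemma HessianTraceAssumption.smooth {L : ℝ} (h : HessianTraceAssumption F η L)
    (hF : ShockAssumption F) (hη : η ≠ 0) (θ d : Vec N) {m a b : ℝ} (hd : ∀ i, |d i| ≤ m)
    (ha : 0 ≤ a) (hb : 0 ≤ b) (hab : a + b = 1) :
    a * socialSurplus F η (θ + b • d) + b * socialSurplus F η (θ - a • d) ≤
      socialSurplus F η θ + L / η / 2 * (a * b) * m ^ 2 := by
  set φ := socialSurplus F η with hφ
  set K := L / η with hK
  -- The Hessian bound says exactly that `q'' ≥ 0`. Convexity is then applied at `b` and `-a`, whose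
  -- average with weights `a`, `b` is `0`.
  set q : ℝ → ℝ := fun t => K * m ^ 2 / 2 * t ^ 2 - φ (θ + t • d) with hq
  have hq1 : ∀ t, HasDerivAt q (K * m ^ 2 * t - inner ℝ (gradient φ (θ + t • d)) d) t := by
    intro t
    have h1 := ((hasDerivAt_pow 2 t).const_mul (K * m ^ 2 / 2)).sub
      (hasDerivAt_comp_line (d := d) (differentiableAt_socialSurplus hF hη (θ + t • d)))
    rw [← inner_gradient_left] at h1
    exact h1.congr_deriv (by simp [hφ]; ring)
  have hq2 : ∀ t, HasDerivAt (deriv q)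
      (K * m ^ 2 - inner ℝ (fderiv ℝ (gradient φ) (θ + t • d) d) d) t := by
    intro t
    rw [funext fun t => (hq1 t).deriv]
    have h1 := ((hasDerivAt_id t).const_mul (K * m ^ 2)).sub
      ((hasDerivAt_comp_line (d := d) (h (θ + t • d)).1).inner ℝ (hasDerivAt_const t d))
    exact h1.congr_deriv (by simp [hφ])
  have hconv : ConvexOn ℝ univ q := by
    refine convexOn_univ_of_deriv2_nonneg (fun t => (hq1 t).differentiableAt)
      (fun t => (hq2 t).differentiableAt) fun t => ?_
    rw [Function.iterate_succ, Function.iterate_one, Function.comp_apply, (hq2 t).deriv,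
      sub_nonneg]
    exact (inner_fderiv_gradient_le hF hη (h _).1 hd).trans
      (mul_le_mul_of_nonneg_right (h _).2 (sq_nonneg m))
  have key := hconv.2 (mem_univ b) (mem_univ (-a)) ha hb hab
  simp only [hq, smul_eq_mul] at key
  rw [show a * b + b * -a = 0 by ring, zero_smul, add_zero, neg_smul, ← sub_eq_add_neg] at key
  have e : a * (K * m ^ 2 / 2 * b ^ 2) + b * (K * m ^ 2 / 2 * (-a) ^ 2) =
      K / 2 * (a * b) * m ^ 2 := by
    obtain rfl : a = 1 - b := by linarith
    ring
  linarith

end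

/-! ### Conjugation: smoothness becomes strong convexity. -/

lemma convexConjugate_le_coe {f : Vec N → ℝ} {x : Vec N} {c : ℝ} :
    convexConjugate f x ≤ c ↔ ∀ z, inner ℝ z x - f z ≤ c := by
  simp only [convexConjugate, iSup_le_iff, EReal.coe_le_coe_iff]

lemma le_convexConjugate (f : Vec N → ℝ) (z x : Vec N) :
    ((inner ℝ z x - f z : ℝ) : EReal) ≤ convexConjugate f x :=
  le_iSup (fun z => ((inner ℝ z x - f z : ℝ) : EReal)) z

lemma convexConjugate_ne_bot (f : Vec N → ℝ) (x : Vec N) : convexConjugate f x ≠ ⊥ :=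
  ((EReal.bot_lt_coe _).trans_le (le_convexConjugate f 0 x)).ne'

/-- If `a f(θ + b d) + b f(θ - a d) ≤ f(θ) + (K / 2) a b ‖d‖_∞²`, then the convex conjugate of `f`
is `1 / K`-strongly convex with respect to the `ℓ¹` norm. -/
lemma stronglyConvexL1_convexConjugate {f : Vec N → ℝ} {K : ℝ} (hK : 0 < K)
    (hf : ∀ (θ d : Vec N) (m a b : ℝ), (∀ i, |d i| ≤ m) → 0 ≤ a → 0 ≤ b → a + b = 1 →
      a * f (θ + b • d) + b * f (θ - a • d) ≤ f θ + K / 2 * (a * b) * m ^ 2) :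
    StronglyConvexL1 (1 / K) (convexConjugate f) := by
  refine ⟨convexConjugate_ne_bot f, fun x y a b ha hb hab => ?_⟩
  have hx' := convexConjugate_ne_bot f x
  have hy' := convexConjugate_ne_bot f y
  have hxy : ∀ z, inner ℝ z x - f z ≤ convexConjugate f x := fun z => le_convexConjugate f z x
  have hyx : ∀ z, inner ℝ z y - f z ≤ convexConjugate f y := fun z => le_convexConjugate f z y
  generalize convexConjugate f x = X at *
  generalize convexConjugate f y = Y at *
  induction X with
  | bot => exact absurd rfl hx'
  | top =>
    rw [EReal.coe_mul_top_of_pos ha, EReal.top_add_of_ne_bot, EReal.top_sub_coe]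
    · exact le_top
    · induction Y with
      | bot => exact absurd rfl hy'
      | top => simp [EReal.coe_mul_top_of_pos hb]
      | coe Y => exact EReal.coe_ne_bot (b * Y)
  | coe X =>
  induction Y with
  | bot => exact absurd rfl hy'
  | top =>
    rw [EReal.coe_mul_top_of_pos hb, ← EReal.coe_mul, EReal.coe_add_top, EReal.top_sub_coe]
    exact le_top
  | coe Y =>
  norm_cast
  rw [convexConjugate_le_coe]
  intro θ
  set S := l1Norm (x - y) with hS
  -- This `d` maximizes `⟨d, x - y⟩ - (K / 2) ‖d‖_∞²`. Testing the conjugate at `x` with `θ + b d`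
  -- and at `y` with `θ - a d` gains `a b S² / K`, of which smoothness costs half.
  set d : Vec N := WithLp.toLp 2 fun i => S / K * SignType.sign ((x - y) i) with hd
  have hS0 : 0 ≤ S := Finset.sum_nonneg fun i _ => abs_nonneg _
  have hdm : ∀ i, |d i| ≤ S / K := fun i => by
    have hs : |((SignType.sign ((x - y) i) : SignType) : ℝ)| ≤ 1 := by
      rcases SignType.sign ((x - y) i) with _ | _ | _ <;> simp
    simp only [hd, abs_mul, abs_of_nonneg (div_nonneg hS0 hK.le)]
    exact mul_le_of_le_one_right (div_nonneg hS0 hK.le) hs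
  have hin : inner ℝ d (x - y) = S ^ 2 / K := by
    rw [inner_eq_sum]
    simp only [hd, mul_assoc, sign_mul_self]
    rw [← Finset.mul_sum]
    change S / K * S = _
    ring
  have h1 := EReal.coe_le_coe_iff.1 (hxy (θ + b • d))
  have h2 := EReal.coe_le_coe_iff.1 (hyx (θ - a • d))
  have h3 := hf θ d (S / K) a b hdm ha.le hb.le hab
  have h4 := mul_le_mul_of_nonneg_left h1 ha.le
  have h5 := mul_le_mul_of_nonneg_left h2 hb.le
  have h6 : inner ℝ θ (a • x + b • y) + a * b * (S ^ 2 / K) =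
      a * inner ℝ (θ + b • d) x + b * inner ℝ (θ - a • d) y := by
    rw [← hin]
    simp only [inner_add_left, inner_sub_left, inner_add_right, inner_sub_right,
      real_inner_smul_left, real_inner_smul_right]
    ring
  have h7 : K / 2 * (a * b) * (S / K) ^ 2 = 1 / K / 2 * (a * b) * S ^ 2 := by
    field_simp
  have h8 : a * b * (S ^ 2 / K) = 2 * (1 / K / 2 * (a * b) * S ^ 2) := by ring
  linarith

/-! ### The simplex and the regularizer on it. -/

lemma eq_zero_of_l1Norm_eq_zero {v : Vec N} (h : l1Norm v = 0) : v = 0 := by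
  rw [← norm_le_zero_iff, ← h]
  exact norm_le_l1Norm v

lemma convex_simplex : Convex ℝ (simplex N) := by
  intro x hx y hy a b ha hb hab
  refine ⟨fun i => ?_, ?_⟩
  · simpa using add_nonneg (mul_nonneg ha (hx.1 i)) (mul_nonneg hb (hy.1 i))
  · simp [Finset.sum_add_distrib, ← Finset.mul_sum, hx.2, hy.2, hab]

lemma pos_of_mem_intrinsicInterior_simplex {x : Vec N}
    (hx : x ∈ intrinsicInterior ℝ (simplex N)) (i : Fin N) : 0 < x i := by
  obtain ⟨p, hp, rfl⟩ := hx
  set e : Vec N := EuclideanSpace.single i 1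
  have he : e ∈ affineSpan ℝ (simplex N) := subset_affineSpan ℝ _ (single_mem_simplex i)
  -- The line from `p` to the vertex `e` can be prolonged slightly backwards inside the simplex; for
  -- `t < 0`, `(1 - t) p i + t ≥ 0` forces `p i > 0`.
  let γ : ℝ → affineSpan ℝ (simplex N) := fun t =>
    ⟨AffineMap.lineMap (p : Vec N) e t, AffineMap.lineMap_mem t p.2 he⟩
  have hγ : Continuous γ := AffineMap.lineMap_continuous.subtype_mk _
  have hγ0 : γ 0 = p := by simp [γ]
  have hev : ∀ᶠ t in 𝓝 (0 : ℝ), (γ t : Vec N) ∈ simplex N := by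
    have : ∀ᶠ q : affineSpan ℝ (simplex N) in 𝓝 (γ 0), (q : Vec N) ∈ simplex N := by
      rw [hγ0]; exact mem_interior_iff_mem_nhds.1 hp
    exact hγ.continuousAt.eventually this
  obtain ⟨t, ht, hlt⟩ := ((hev.filter_mono nhdsWithin_le_nhds).and
    (self_mem_nhdsWithin (s := Iio (0 : ℝ)))).exists
  have h := ht.1 i
  have hlt : t < 0 := hlt
  simp only [γ, AffineMap.lineMap_apply, e, vsub_eq_sub, vadd_eq_add, PiLp.add_apply,
    PiLp.smul_apply, PiLp.sub_apply, PiLp.single_eq_same, smul_eq_mul] at h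
  nlinarith

lemma inner_ones (x : Vec N) : inner ℝ (ones N) x = ∑ i, x i := by simp [inner_eq_sum]

lemma isClosed_sum_eq_zero : IsClosed {θ : Vec N | ∑ i, θ i = 0} :=
  isClosed_eq (by fun_prop) continuous_const

variable [NeZero N]

lemma socialSurplus_smul (hη : 0 ≤ η) (F : Measure (Vec N)) (z : Vec N) :
    socialSurplus F η (η • z) = η * socialSurplus F 1 z := by
  simp only [socialSurplus_eq, ← smul_add, maxCoord_smul hη, integral_const_mul, one_smul]

lemma regularizer_eq_convexConjugate (hη : 0 < η) (F : Measure (Vec N)) (x : Vec N) :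
    regularizer F η x = convexConjugate (socialSurplus F η) x := by
  have key : ∀ z : Vec N, inner ℝ (η • z) x - socialSurplus F η (η • z) =
      η * (inner ℝ z x - socialSurplus F 1 z) := fun z => by
    rw [socialSurplus_smul hη.le, real_inner_smul_left]; ring
  apply le_antisymm
  · have h : convexConjugate (socialSurplus F 1) x ≤
        ((η⁻¹ : ℝ) : EReal) * convexConjugate (socialSurplus F η) x := by
      refine iSup_le fun z => ?_
      have := mul_le_mul_of_nonneg_left (le_convexConjugate (socialSurplus F η) (η • z) x)
        (show (0 : EReal) ≤ ((η⁻¹ : ℝ) : EReal) by exact_mod_cast (inv_pos.2 hη).le)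
      rwa [key, ← EReal.coe_mul, inv_mul_cancel_left₀ hη.ne'] at this
    have := mul_le_mul_of_nonneg_left h (show (0 : EReal) ≤ (η : EReal) by exact_mod_cast hη.le)
    rwa [← mul_assoc, ← EReal.coe_mul, mul_inv_cancel₀ hη.ne', EReal.coe_one, one_mul] at this
  · refine iSup_le fun θ => ?_
    have := mul_le_mul_of_nonneg_left (le_convexConjugate (socialSurplus F 1) (η⁻¹ • θ) x)
      (show (0 : EReal) ≤ (η : EReal) by exact_mod_cast hη.le)
    rwa [← EReal.coe_mul, ← key, smul_inv_smul₀ hη.ne'] at this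

lemma convexConjugate_ne_top_of_mem_simplex (hF : ShockAssumption F) {x : Vec N}
    (hx : x ∈ simplex N) : convexConjugate (socialSurplus F η) x ≠ ⊤ := by
  refine ((convexConjugate_le_coe (c := 0)).2 fun z => ?_).trans_lt (EReal.coe_lt_top 0) |>.ne
  exact sub_nonpos.2 (inner_le_socialSurplus hF hx z)

/-- The convex conjugate of the surplus as a real-valued function (on the simplex). -/
def realConjugate (F : Measure (Vec N)) (η : ℝ) (x : Vec N) : ℝ :=
  (convexConjugate (socialSurplus F η) x).toReal

lemma coe_realConjugate (hF : ShockAssumption F) {x : Vec N} (hx : x ∈ simplex N) :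
    (realConjugate F η x : EReal) = convexConjugate (socialSurplus F η) x :=
  EReal.coe_toReal (convexConjugate_ne_top_of_mem_simplex hF hx) (convexConjugate_ne_bot _ _)

lemma le_realConjugate (hF : ShockAssumption F) {x : Vec N} (hx : x ∈ simplex N) (z : Vec N) :
    inner ℝ z x - socialSurplus F η z ≤ realConjugate F η x := by
  have := le_convexConjugate (socialSurplus F η) z x
  rw [← coe_realConjugate hF hx] at this
  exact_mod_cast this

lemma realConjugate_le (hF : ShockAssumption F) {x : Vec N} (hx : x ∈ simplex N) {c : ℝ}
    (h : ∀ z, inner ℝ z x - socialSurplus F η z ≤ c) : realConjugate F η x ≤ c := by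
  have := convexConjugate_le_coe.2 h
  rw [← coe_realConjugate hF hx] at this
  exact_mod_cast this

/-- On the simplex it suffices to take the supremum over vectors with zero sum. -/
lemma realConjugate_le_of_sum_eq_zero (hF : ShockAssumption F) {x : Vec N} (hx : x ∈ simplex N)
    {c : ℝ} (h : ∀ z : Vec N, ∑ i, z i = 0 → inner ℝ z x - socialSurplus F η z ≤ c) :
    realConjugate F η x ≤ c := by
  refine realConjugate_le hF hx fun z => ?_
  have hN : (N : ℝ) ≠ 0 := NeZero.ne _
  have := h (z + (-(∑ i, z i) / N) • ones N) (by
    simp [Finset.sum_add_distrib]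
    field_simp
    ring)
  rw [socialSurplus_add_smul_ones hF, inner_add_left, real_inner_smul_left, inner_ones, hx.2]
    at this
  linarith

/-! ### Coercivity on zero-sum vectors and differentiability of the conjugate. -/

lemma abs_apply_mul_le (hF : ShockAssumption F) {x : Vec N} (hx : x ∈ simplex N) {δ : ℝ}
    (hδ : 0 < δ) (hδx : ∀ i, δ ≤ x i) {θ : Vec N} (hθ : ∑ i, θ i = 0) (i : Fin N) :
    δ * |θ i| ≤ socialSurplus F η θ - inner ℝ θ x := by
  have hgap : ∀ k, δ * (maxCoord θ - θ k) ≤ socialSurplus F η θ - inner ℝ θ x := fun k =>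
    calc δ * (maxCoord θ - θ k) ≤ x k * (maxCoord θ - θ k) :=
          mul_le_mul_of_nonneg_right (hδx k) (sub_nonneg.2 (le_maxCoord θ k))
      _ ≤ ∑ j, x j * (maxCoord θ - θ j) :=
          Finset.single_le_sum (f := fun j => x j * (maxCoord θ - θ j))
            (fun j _ => mul_nonneg (hx.1 j) (sub_nonneg.2 (le_maxCoord θ j))) (Finset.mem_univ k)
      _ = maxCoord θ - inner ℝ θ x := by
          simp only [mul_sub, Finset.sum_sub_distrib, ← Finset.sum_mul, hx.2, one_mul,
            real_inner_comm x θ, inner_eq_sum]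
      _ ≤ _ := sub_le_sub_right (maxCoord_le_socialSurplus hF θ) _
  -- Zero sum gives a coordinate `θ j ≤ 0` and a maximum `≥ 0`, so `|θ i|` is at most the gap below
  -- the maximum at `j` or at `i`.
  obtain ⟨j, -, hj⟩ : ∃ j ∈ Finset.univ, θ j ≤ 0 :=
    Finset.exists_le_of_sum_le (g := fun _ => (0 : ℝ)) Finset.univ_nonempty (by simp [hθ])
  obtain ⟨k, -, hk⟩ : ∃ k ∈ Finset.univ, 0 ≤ θ k :=
    Finset.exists_le_of_sum_le (f := fun _ => (0 : ℝ)) Finset.univ_nonempty (by simp [hθ])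
  have hM := hk.trans (le_maxCoord θ k)
  rcases abs_cases (θ i) with ⟨h, _⟩ | ⟨h, _⟩ <;> rw [h]
  · refine le_trans (mul_le_mul_of_nonneg_left ?_ hδ.le) (hgap j)
    linarith [le_maxCoord θ i]
  · refine le_trans (mul_le_mul_of_nonneg_left ?_ hδ.le) (hgap i)
    linarith

lemma continuous_socialSurplus (hF : ShockAssumption F) (hη : η ≠ 0) :
    Continuous (socialSurplus F η) :=
  continuous_iff_continuousAt.2 fun θ => (differentiableAt_socialSurplus hF hη θ).continuousAt

lemma exists_minimizer (hF : ShockAssumption F) (hη : η ≠ 0) {x : Vec N} (hx : x ∈ simplex N)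
    (hpos : ∀ i, 0 < x i) :
    ∃ θ : Vec N, ∑ i, θ i = 0 ∧ ∀ θ' : Vec N, ∑ i, θ' i = 0 →
      socialSurplus F η θ - inner ℝ θ x ≤ socialSurplus F η θ' - inner ℝ θ' x := by
  obtain ⟨k, hk⟩ := Finite.exists_min fun i => x i
  have hc : Continuous fun θ : Vec N => socialSurplus F η θ - inner ℝ θ x :=
    (continuous_socialSurplus hF hη).sub (by fun_prop)
  obtain ⟨θ, hθ, hmin⟩ := hc.continuousOn.exists_isMinOn' (x₀ := 0) isClosed_sum_eq_zero
    (by simp) (by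
      rw [eventually_inf_principal]
      filter_upwards [tendsto_norm_cocompact_atTop.eventually_ge_atTop
        (N * ((socialSurplus F η 0 - inner ℝ 0 x) / x k))] with θ hθ hsum
      have h1 : x k * ‖θ‖ ≤ N * (socialSurplus F η θ - inner ℝ θ x) :=
        calc x k * ‖θ‖ ≤ x k * l1Norm θ :=
              mul_le_mul_of_nonneg_left (norm_le_l1Norm θ) (hpos k).le
          _ = ∑ i, x k * |θ i| := Finset.mul_sum _ _ _
          _ ≤ ∑ i : Fin N, (socialSurplus F η θ - inner ℝ θ x) :=
              Finset.sum_le_sum fun i _ => abs_apply_mul_le hF hx (hpos k) hk hsum i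
          _ = _ := by simp [mul_sub]
      have h2 := mul_le_mul_of_nonneg_left hθ (hpos k).le
      have h3 : x k * (N * ((socialSurplus F η 0 - inner ℝ 0 x) / x k)) =
          N * (socialSurplus F η 0 - inner ℝ 0 x) := by
        have := (hpos k).ne'
        field_simp
      rw [h3] at h2
      exact le_of_mul_le_mul_left (h2.trans h1) (Nat.cast_pos.2 (NeZero.pos N)))
  exact ⟨θ, hθ, fun θ' hθ' => hmin hθ'⟩

lemma lt_of_minimizer_ne (hF : ShockAssumption F) (hη : η ≠ 0) {x θ : Vec N}
    (hθ : ∑ i, θ i = 0) (hmin : ∀ θ' : Vec N, ∑ i, θ' i = 0 →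
      socialSurplus F η θ - inner ℝ θ x ≤ socialSurplus F η θ' - inner ℝ θ' x)
    {θ' : Vec N} (hθ' : ∑ i, θ' i = 0) (hne : θ' ≠ θ) :
    socialSurplus F η θ - inner ℝ θ x < socialSurplus F η θ' - inner ℝ θ' x := by
  refine (hmin θ' hθ').lt_of_ne fun heq => hne ?_
  have hconv := (convexOn_socialSurplus (η := η) hF).2 (mem_univ θ') (mem_univ θ)
    (by norm_num : (0 : ℝ) ≤ 1 / 2) (by norm_num : (0 : ℝ) ≤ 1 / 2) (by norm_num)
  have hmid := hmin ((1 / 2 : ℝ) • θ' + (1 / 2 : ℝ) • θ)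
    (by simp [Finset.sum_add_distrib, ← Finset.mul_sum, hθ, hθ'])
  rw [inner_add_left, real_inner_smul_left, real_inner_smul_left] at hmid
  simp only [smul_eq_mul] at hconv
  exact eq_of_socialSurplus_midpoint_eq hF hη (hθ'.trans hθ.symm) (by linarith)

/-- A unique minimizer of `φ - ⟨·, x⟩` on the vectors with zero sum is a gradient of `φ*` at `x`. -/
lemma hasFDerivWithinAt_realConjugate (hF : ShockAssumption F) (hη : η ≠ 0) {x θ : Vec N}
    (hx : x ∈ simplex N) (hθ : ∑ i, θ i = 0) (hmin : ∀ θ' : Vec N, ∑ i, θ' i = 0 →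
      socialSurplus F η θ - inner ℝ θ x ≤ socialSurplus F η θ' - inner ℝ θ' x) :
    HasFDerivWithinAt (realConjugate F η) (innerSL ℝ θ) (simplex N) x := by
  have hval : realConjugate F η x = inner ℝ θ x - socialSurplus F η θ :=
    le_antisymm (realConjugate_le_of_sum_eq_zero hF hx fun z hz => by linarith [hmin z hz])
      (le_realConjugate hF hx θ)
  have hc : Continuous fun θ : Vec N => socialSurplus F η θ - inner ℝ θ x :=
    (continuous_socialSurplus hF hη).sub (by fun_prop)
  rw [hasFDerivWithinAt_iff_isLittleO, Asymptotics.isLittleO_iff]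
  intro c hcpos
  -- Strict minimality plus compactness of the sphere gives a uniform gap `κ`. Convexity makes the
  -- gap grow at least linearly outside, so for `‖y - x‖ < κ / c` only `z` within `c` of `θ` can
  -- exceed the linear approximation.
  obtain ⟨κ, hκ, hgap⟩ : ∃ κ > 0, ∀ p : Vec N, ∑ i, p i = 0 → ‖p - θ‖ = c →
      socialSurplus F η θ - inner ℝ θ x + κ ≤ socialSurplus F η p - inner ℝ p x := by
    have hcomp : IsCompact (Metric.sphere θ c ∩ {p : Vec N | ∑ i, p i = 0}) :=
      (isCompact_sphere θ c).inter_right isClosed_sum_eq_zero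
    rcases (Metric.sphere θ c ∩ {p : Vec N | ∑ i, p i = 0}).eq_empty_or_nonempty with he | hne
    · refine ⟨1, one_pos, fun p hp hpc => ?_⟩
      have : p ∈ Metric.sphere θ c ∩ {p : Vec N | ∑ i, p i = 0} :=
        ⟨by simpa [dist_eq_norm] using hpc, hp⟩
      simp [he] at this
    · obtain ⟨q, hq, hqmin⟩ := hcomp.exists_isMinOn hne hc.continuousOn
      have hqne : q ≠ θ := by
        rintro rfl
        exact hcpos.ne ((dist_self q).symm.trans hq.1)
      refine ⟨_, sub_pos.2 (lt_of_minimizer_ne hF hη hθ hmin hq.2 hqne), fun p hp hpc => ?_⟩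
      have : socialSurplus F η q - inner ℝ q x ≤ socialSurplus F η p - inner ℝ p x :=
        hqmin ⟨by simpa [dist_eq_norm] using hpc, hp⟩
      linarith
  filter_upwards [self_mem_nhdsWithin,
    mem_nhdsWithin_of_mem_nhds (Metric.ball_mem_nhds x (div_pos hκ hcpos))] with y hy hyx
  rw [Metric.mem_ball, dist_eq_norm, lt_div_iff₀ hcpos] at hyx
  have hlow := le_realConjugate (η := η) hF hy θ
  have hup : realConjugate F η y ≤ realConjugate F η x + inner ℝ θ (y - x) + c * ‖y - x‖ := by
    refine realConjugate_le_of_sum_eq_zero hF hy fun z hz => ?_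
    have hcs : inner ℝ (z - θ) (y - x) ≤ ‖z - θ‖ * ‖y - x‖ := real_inner_le_norm _ _
    have hmz := hmin z hz
    simp only [inner_sub_left, inner_sub_right] at hcs ⊢
    rcases le_or_gt ‖z - θ‖ c with hle | hgt
    · have := mul_le_mul_of_nonneg_right hle (norm_nonneg (y - x))
      linarith
    · have hr : 0 < ‖z - θ‖ := hcpos.trans hgt
      set t := c / ‖z - θ‖ with ht
      have ht0 : 0 < t := div_pos hcpos hr
      have ht1 : t < 1 := (div_lt_one hr).2 hgt
      have htr : t * ‖z - θ‖ = c := div_mul_cancel₀ _ hr.ne'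
      have hp := hgap ((1 - t) • θ + t • z)
        (by simp [Finset.sum_add_distrib, ← Finset.mul_sum, hθ, hz])
        (by rw [show (1 - t) • θ + t • z - θ = t • (z - θ) by module, norm_smul,
          Real.norm_of_nonneg ht0.le, htr])
      have hconv := (convexOn_socialSurplus (η := η) hF).2 (mem_univ θ) (mem_univ z)
        (sub_nonneg.2 ht1.le) ht0.le (by ring)
      rw [inner_add_left, real_inner_smul_left, real_inner_smul_left] at hp
      simp only [smul_eq_mul] at hconv
      have h1 : κ ≤ t * ((socialSurplus F η z - inner ℝ z x) -
          (socialSurplus F η θ - inner ℝ θ x)) := by linarith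
      have h2 : t * (‖z - θ‖ * ‖y - x‖) < κ := by
        rw [← mul_assoc, htr, mul_comm]; exact hyx
      have h3 := lt_of_mul_lt_mul_left (h2.trans_le h1) ht0.le
      have := mul_nonneg hcpos.le (norm_nonneg (y - x))
      linarith
  rw [innerSL_apply_apply, Real.norm_of_nonneg]
  · linarith
  · rw [inner_sub_right]; linarith

/-! ### The gradient of the surplus as the unique solution. -/

lemma gradient_le_sub (hF : ShockAssumption F) (hη : η ≠ 0) (θ z : Vec N) :
    inner ℝ (gradient (socialSurplus F η) θ) (z - θ) ≤
      socialSurplus F η z - socialSurplus F η θ := by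
  have hd := hasDerivAt_comp_line (t := 0) (d := z - θ) (f := socialSurplus F η) (θ := θ)
    (differentiableAt_socialSurplus hF hη _)
  have hconv : ConvexOn ℝ univ fun t : ℝ => socialSurplus F η (θ + t • (z - θ)) := by
    refine ⟨convex_univ, fun s _ t _ a b ha hb hab => ?_⟩
    have := (convexOn_socialSurplus (η := η) hF).2 (mem_univ (θ + s • (z - θ)))
      (mem_univ (θ + t • (z - θ))) ha hb hab
    obtain rfl : a = 1 - b := by linarith
    convert this using 2
    simp only [smul_eq_mul]
    module
  have := hconv.le_slope_of_hasDerivAt (mem_univ 0) (mem_univ 1) one_pos hd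
  rw [slope_def_field, ← inner_gradient_left] at this
  simpa using this

/-- Monotonicity of `φ` gives nonnegative partial derivatives; unit slope along `ones` gives total
mass `1`. -/
lemma gradient_mem_simplex (hF : ShockAssumption F) (hη : η ≠ 0) (θ : Vec N) :
    gradient (socialSurplus F η) θ ∈ simplex N := by
  have hd := differentiableAt_socialSurplus hF hη
  refine ⟨fun i => ?_, ?_⟩
  · have h := hasDerivAt_comp_line (t := 0) (d := EuclideanSpace.single i (1 : ℝ))
      (f := socialSurplus F η) (θ := θ) (hd _)
    have := h.nonneg_of_monotone fun s t hst => socialSurplus_mono hF fun k => by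
      by_cases hk : k = i <;> simp [hk, hst]
    simpa [gradient_apply] using this
  · have h := hasDerivAt_comp_line (t := 0) (d := ones N) (f := socialSurplus F η) (θ := θ) (hd _)
    simp only [socialSurplus_add_smul_ones hF] at h
    have h1 := h.unique ((hasDerivAt_id (0 : ℝ)).const_add (socialSurplus F η θ))
    rw [zero_smul, add_zero, ← inner_gradient_left, real_inner_comm, inner_ones] at h1
    exact h1

lemma realConjugate_gradient (hF : ShockAssumption F) (hη : η ≠ 0) (θ : Vec N) :
    realConjugate F η (gradient (socialSurplus F η) θ) =
      inner ℝ θ (gradient (socialSurplus F η) θ) - socialSurplus F η θ := by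
  have hmem := gradient_mem_simplex hF hη θ
  refine le_antisymm (realConjugate_le hF hmem fun z => ?_) (le_realConjugate hF hmem θ)
  have := gradient_le_sub hF hη θ z
  rw [real_inner_comm, inner_sub_left] at this
  linarith

lemma isSolution_iff (hF : ShockAssumption F) (hη : 0 < η) {θ x : Vec N} :
    IsSolution F η θ x ↔ x ∈ simplex N ∧ ∀ y ∈ simplex N,
      inner ℝ θ y - realConjugate F η y ≤ inner ℝ θ x - realConjugate F η x := by
  refine and_congr_right fun hx => forall₂_congr fun y hy => ?_
  simp only [mem_ofPred_eq, regularizer_eq_convexConjugate hη, ← coe_realConjugate hF hx,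
    ← coe_realConjugate hF hy]
  norm_cast

lemma isSolution_gradient (hF : ShockAssumption F) (hη : 0 < η) (θ : Vec N) :
    IsSolution F η θ (gradient (socialSurplus F η) θ) := by
  refine (isSolution_iff hF hη).2 ⟨gradient_mem_simplex hF hη.ne' θ, fun y hy => ?_⟩
  rw [realConjugate_gradient hF hη.ne']
  linarith [le_realConjugate (η := η) hF hy θ]

lemma IsSolution.unique (hF : ShockAssumption F) (hη : 0 < η) {σ : ℝ} (hσ : 0 < σ)
    (hR : StronglyConvexL1 σ (convexConjugate (socialSurplus F η))) {θ x y : Vec N}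
    (hx : IsSolution F η θ x) (hy : IsSolution F η θ y) : x = y := by
  rw [isSolution_iff hF hη] at hx hy
  have hmid : (1 / 2 : ℝ) • x + (1 / 2 : ℝ) • y ∈ simplex N :=
    convex_simplex hx.1 hy.1 (by norm_num) (by norm_num) (by norm_num)
  have h := hR.2 x y (1 / 2) (1 / 2) (by norm_num) (by norm_num) (by norm_num)
  rw [← coe_realConjugate hF hmid, ← coe_realConjugate hF hx.1, ← coe_realConjugate hF hy.1] at h
  norm_cast at h
  have h1 := hx.2 _ hmid
  have h2 := hy.2 _ hmid
  rw [inner_add_right, real_inner_smul_right, real_inner_smul_right] at h1 h2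
  have h3 : σ / 8 * l1Norm (x - y) ^ 2 ≤ 0 := by linarith
  have h4 : l1Norm (x - y) ^ 2 ≤ 0 := nonpos_of_mul_nonpos_right h3 (by positivity)
  exact sub_eq_zero.1 (eq_zero_of_l1Norm_eq_zero (pow_eq_zero_iff two_ne_zero |>.1
    (h4.antisymm (sq_nonneg _))))

end RUM

end

theorem mainTheorem4 (N : ℕ) (hN : 1 ≤ N) (η L : ℝ) (hη : 0 < η) (hL : 0 < L)
    (F : Measure (RUM.Vec N)) (hF : RUM.ShockAssumption F)
    (hHess : RUM.HessianTraceAssumption F η L) :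
    RUM.StronglyConvexL1 (η / L) (RUM.regularizer F η) ∧
    ((∀ x ∈ RUM.simplex N, RUM.regularizer F η x ≠ ⊥ ∧ RUM.regularizer F η x ≠ ⊤) ∧
      ∀ x ∈ intrinsicInterior ℝ (RUM.simplex N),
        DifferentiableWithinAt ℝ (fun y => (RUM.regularizer F η y).toReal) (RUM.simplex N) x) ∧
    (∀ θ : RUM.Vec N,
      (∃! x, RUM.IsSolution F η θ x) ∧
      DifferentiableAt ℝ (RUM.socialSurplus F η) θ ∧
      RUM.IsSolution F η θ (gradient (RUM.socialSurplus F η) θ)) := by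
  have : NeZero N := ⟨by omega⟩
  have hreg : RUM.regularizer F η = RUM.convexConjugate (RUM.socialSurplus F η) :=
    funext fun x => RUM.regularizer_eq_convexConjugate hη F x
  have hR : RUM.StronglyConvexL1 (η / L) (RUM.convexConjugate (RUM.socialSurplus F η)) := by
    rw [← one_div_div]
    exact RUM.stronglyConvexL1_convexConjugate (div_pos hL hη) fun θ d m a b hd ha hb hab =>
      hHess.smooth hF hη.ne' θ d hd ha hb hab
  refine ⟨hreg ▸ hR, ⟨fun x hx => ?_, fun x hx => ?_⟩, fun θ =>
    ⟨⟨_, RUM.isSolution_gradient hF hη θ, fun y hy => RUM.IsSolution.unique hF hη (div_pos hη hL) hR hy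
      (RUM.isSolution_gradient hF hη θ)⟩, RUM.differentiableAt_socialSurplus hF hη.ne' θ,
    RUM.isSolution_gradient hF hη θ⟩⟩
  · rw [hreg]
    exact ⟨RUM.convexConjugate_ne_bot _ _, RUM.convexConjugate_ne_top_of_mem_simplex hF hx⟩
  · have hxs := intrinsicInterior_subset hx
    obtain ⟨θ, hθ, hmin⟩ := RUM.exists_minimizer hF hη.ne' hxs
      (RUM.pos_of_mem_intrinsicInterior_simplex hx)
    rw [hreg]
    exact (RUM.hasFDerivWithinAt_realConjugate hF hη.ne' hxs hθ hmin).differentiableWithinAt
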